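/- Let $G$ be a connected undirected simple graph with $N$ nodes and $M$ edges. Label the edges $1,\dots,M$, label one end of each edge positive and the other negative, and let $D=(d_{ik})\in\mathbb{R}^{N\times M}$ be the incidence matrix: $d_{ik}=1$ if node $i$ is the positive end of edge $k$, $d_{ik}=-1$ if it is the negative end, and $d_{ik}=0$ otherwise. Let $A\in\mathbb{R}^{n\times n}$, $B\in\mathbb{R}^{n\times p}$, $C\in\mathbb{R}^{p\times n}$ be such that there is a symmetric positive definite matrix $P\in\mathbb{R}^{n\times n}$ with $A^TP+PA\le 0$ and $B^TP=C$. Let $\Delta>0$, let $q_\Delta(r)=\Delta\lfloor r/\Delta+1/2\rfloor$ for $r\in\mathbb{R}$, and let $q_\Delta$ act componentwise on vectors. Consider on $\mathbb{R}^{nN}$ the closed-loop system $$\dot\xi=F(\xi):=(I_N\otimes A)\xi-(I_N\otimes B)(D\otimes I_p)\,q_\Delta(z),\qquad z=(D^T\otimes I_p)(I_N\otimes C)\xi ,$$ and write $z=(z_{kj})$ with $1\le k\le M$, $1\le j\le p$. A Krasowskii solution on an interval $I\subseteq\mathbb{R}$ is a function $\xi:I\to\mathbb{R}^{nN}$, absolutely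 continuous on the compact subintervals of $I$, with $\dot\xi(t)\in\bigcap_{\delta>0}\overline{\mathrm{co}}\,F(B(\xi(t),\delta))$ for almost every $t\in I$. A set $S\subseteq\mathbb{R}^{nN}$ is weakly invariant if for every $\bar\xi\in S$ there is a Krasowskii solution $\xi$ on $[0,\infty)$ with $\xi(0)=\bar\xi$ and $\xi(t)\in S$ for all $t\ge 0$. Then every Krasowskii solution on an interval with least element $0$ extends to a Krasowskii solution on $[0,\infty)$, and every Krasowskii solution $\xi$ on $[0,\infty)$ converges, as $t\to\infty$, to the largest weakly invariant subset $\mathcal{W}$ of $$\Big\{\xi\in\mathbb{R}^{nN}:\ |z_{kj}|\le \tfrac{\Delta}{2}\ \text{ for all } k=1,\dots,M,\ j=1,\dots,p\Big\},$$ that is, $\mathcal{W}$ is non-empty and $\mathrm{dist}(\xi(t),\mathcal{W})\to 0$ as $t\to\infty$. -/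

import Mathlib

open Set Filter Topology MeasureTheory Matrix
open scoped Kronecker

namespace QuantSync

noncomputable section

/-! ### Krasowskii solutions and weak invariance -/

section Krasowskii

variable {E : Type*} [NormedAddCommGroup E] [NormedSpace ℝ E]

/-- The Krasowskii regularization of a vector field `F`: the intersection over `δ > 0` of the
closed convex hulls of `F (B(x, δ))`. -/
def krasowskii (F : E → E) (x : E) : Set E :=
  ⋂ (δ : ℝ) (_ : 0 < δ), closedConvexHull ℝ (F '' Metric.ball x δ)

/-- `x` is a Krasowskii solution of `x' = F x` on the interval `I`: it is absolutely continuous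
(on every compact subinterval of `I`), and for almost every `t ∈ I` its derivative exists and lies
in the Krasowskii regularization of `F` at `x t`. Values of `x` outside `I` play no role. -/
structure IsKrasowskiiSolutionOn (F : E → E) (I : Set ℝ) (x : ℝ → E) : Prop where
  absolutelyContinuous : ∀ a ∈ I, ∀ b ∈ I, AbsolutelyContinuousOnInterval x a b
  ae_hasDerivAt : ∀ᵐ t ∂(volume.restrict I), ∃ v ∈ krasowskii F (x t), HasDerivAt x v t

/-- `S` is weakly invariant for `x' = F x`: from each of its points starts at least one Krasowskii
solution on `[0, ∞)` that stays in `S`. -/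
def WeaklyInvariant (F : E → E) (S : Set E) : Prop :=
  ∀ x₀ ∈ S, ∃ x : ℝ → E, IsKrasowskiiSolutionOn F (Ici 0) x ∧ x 0 = x₀ ∧ ∀ t ∈ Ici (0 : ℝ), x t ∈ S

/-- The largest weakly invariant subset of `S`, obtained as the union of all of them. -/
def largestWeaklyInvariantSubset (F : E → E) (S : Set E) : Set E :=
  ⋃₀ {W | W ⊆ S ∧ WeaklyInvariant F W}

/-- The union of all weakly invariant subsets of `S` is indeed the largest one. -/
theorem isGreatest_largestWeaklyInvariantSubset (F : E → E) (S : Set E) :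
    IsGreatest {W | W ⊆ S ∧ WeaklyInvariant F W} (largestWeaklyInvariantSubset F S) := by
  refine ⟨⟨sUnion_subset fun W hW => hW.1, ?_⟩, fun W hW => subset_sUnion_of_mem hW⟩
  rintro x₀ ⟨W, hW, hx₀⟩
  obtain ⟨x, hx, h0, hmem⟩ := hW.2 x₀ hx₀
  exact ⟨x, hx, h0, fun t ht => ⟨W, hW, hmem t ht⟩⟩

/-- `x t` converges to the set `S` as `t → ∞`: its distance to `S` tends to zero
(in particular `S` is not empty). -/
def ConvergesToSet (x : ℝ → E) (S : Set E) : Prop :=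
  ∀ ε > (0 : ℝ), ∃ T : ℝ, ∀ t ≥ T, ∃ s ∈ S, dist (x t) s < ε

end Krasowskii

/-! ### Graphs, quantizer, passive agents -/

/-- A labelling of the edges of `G` by `1, …, M`, with one end of every edge labelled positive and
the other one negative: each edge of `G` is `{pos k, neg k}` for exactly one `k`. -/
structure EdgeLabelling {V : Type*} (G : SimpleGraph V) (M : ℕ) where
  pos : Fin M → V
  neg : Fin M → V
  bijOn : BijOn (fun k => s(pos k, neg k)) univ G.edgeSet

/-- The incidence matrix: `+1` at the positive end of edge `k`, `-1` at its negative end. -/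
def EdgeLabelling.incidence {V : Type*} [DecidableEq V] {G : SimpleGraph V} {M : ℕ}
    (L : EdgeLabelling G M) : Matrix V (Fin M) ℝ :=
  Matrix.of fun i k => if i = L.pos k then 1 else if i = L.neg k then -1 else 0

/-- The uniform quantizer with resolution `Δ`. -/
def quantizer (Δ r : ℝ) : ℝ := Δ * (⌊r / Δ + 1 / 2⌋ : ℝ)

/-- The passivity assumption on `(A, B, C)`: there is a symmetric positive definite `P` with
`AᵀP + PA ≤ 0` and `BᵀP = C`. -/
def PassivityAssumption {n p : ℕ} (A : Matrix (Fin n) (Fin n) ℝ) (B : Matrix (Fin n) (Fin p) ℝ)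
    (C : Matrix (Fin p) (Fin n) ℝ) : Prop :=
  ∃ P : Matrix (Fin n) (Fin n) ℝ, P.PosDef ∧ (-(Aᵀ * P + P * A)).PosSemidef ∧ Bᵀ * P = C

section ClosedLoop

variable {N M n p : ℕ}

/-- The relative outputs `z = (Dᵀ ⊗ I_p) (I_N ⊗ C) ξ`. The coordinate `(k, j)` of `z` is `z_{kj}`,
the coordinate `(i, l)` of `ξ` is the `l`-th coordinate of the state of agent `i`. -/
def relativeOutput (D : Matrix (Fin N) (Fin M) ℝ) (C : Matrix (Fin p) (Fin n) ℝ)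
    (ξ : Fin N × Fin n → ℝ) : Fin M × Fin p → ℝ :=
  (Dᵀ ⊗ₖ (1 : Matrix (Fin p) (Fin p) ℝ)) *ᵥ (((1 : Matrix (Fin N) (Fin N) ℝ) ⊗ₖ C) *ᵥ ξ)

/-- The quantized output feedback `u = -(D ⊗ I_p) q_Δ(z)`. -/
def quantizedFeedback (Δ : ℝ) (D : Matrix (Fin N) (Fin M) ℝ) (C : Matrix (Fin p) (Fin n) ℝ)
    (ξ : Fin N × Fin n → ℝ) : Fin N × Fin p → ℝ :=
  -((D ⊗ₖ (1 : Matrix (Fin p) (Fin p) ℝ)) *ᵥ fun a => quantizer Δ (relativeOutput D C ξ a))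

/-- The closed-loop vector field
`F(ξ) = (I_N ⊗ A) ξ + (I_N ⊗ B) u = (I_N ⊗ A) ξ - (I_N ⊗ B) (D ⊗ I_p) q_Δ(z)`. -/
def closedLoop (Δ : ℝ) (D : Matrix (Fin N) (Fin M) ℝ) (A : Matrix (Fin n) (Fin n) ℝ)
    (B : Matrix (Fin n) (Fin p) ℝ) (C : Matrix (Fin p) (Fin n) ℝ)
    (ξ : Fin N × Fin n → ℝ) : Fin N × Fin n → ℝ :=
  ((1 : Matrix (Fin N) (Fin N) ℝ) ⊗ₖ A) *ᵥ ξ +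
    ((1 : Matrix (Fin N) (Fin N) ℝ) ⊗ₖ B) *ᵥ quantizedFeedback Δ D C ξ

/-- The set `{ξ : |z_{kj}| ≤ Δ / 2 for all k, j}`. -/
def practicalSyncSet (Δ : ℝ) (D : Matrix (Fin N) (Fin M) ℝ) (C : Matrix (Fin p) (Fin n) ℝ) :
    Set (Fin N × Fin n → ℝ) :=
  {ξ | ∀ (k : Fin M) (j : Fin p), |relativeOutput D C ξ (k, j)| ≤ Δ / 2}

end ClosedLoop

end

end QuantSync

open QuantSync

/-! In the scalar product of `I_N ⊗ P` the closed loop is dissipative: by `AᵀP + PA ≤ 0` and `BᵀP =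
C`, the product of `F x - F y` with `x - y` is at most minus the pairing of the differences of
quantized and of true relative outputs, and the quantizer is nondecreasing
(`closedLoop_isDissipative`). This passes to the Krasowskii regularization
(`IsDissipative.krasowskii_dissip`), so solutions never move apart (`IsDissipative.form_sub_le`) and
are unique forward in time. The same inequality makes Euler polygons Cauchy; their limit is a global
solution (`IsDissipative.exists_solution`), which by uniqueness extends any given one.

For convergence, let `V x = b x x`. Nonexpansiveness makes the ω-limit set invariant, and `V` is
constant on it; off the target set `V` decreases at rate at least `Δ ^ 2`. Hence the ω-limit set
lies in the target set, is weakly invariant, and attracts the bounded trajectory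
(`IsDissipative.convergesToSet`). -/

namespace QuantSync

/-! ### Dissipative fields and Euler polygons -/

section Dissipative

variable {E : Type*} [NormedAddCommGroup E] [NormedSpace ℝ E]

/-- `F` has linear growth and is dissipative for the scalar product `b`. -/
structure IsDissipative (b : E →L[ℝ] E →L[ℝ] ℝ) (F : E → E) : Prop where
  symm : ∀ x y, b x y = b y x
  coercive : ∃ c > 0, ∀ x, c * ‖x‖ ^ 2 ≤ b x x
  growth : ∃ β ≥ 0, ∀ x, ‖F x‖ ≤ β * (1 + ‖x‖)
  dissip : ∀ x y, b (F x - F y) (x - y) ≤ 0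

/-- The points of the explicit Euler scheme with step `h`. -/
def eulerSeq (F : E → E) (h : ℝ) (x₀ : E) (k : ℕ) : E := (fun x => x + h • F x)^[k] x₀

/-- The piecewise constant velocity of the Euler polygon with step `h`. -/
noncomputable def eulerSlope (F : E → E) (h : ℝ) (x₀ : E) (s : ℝ) : E :=
  F (eulerSeq F h x₀ ⌊s / h⌋₊)

/-- The Euler polygon with step `h`. -/
noncomputable def eulerPath (F : E → E) (h : ℝ) (x₀ : E) (t : ℝ) : E :=
  x₀ + ∫ s in (0 : ℝ)..t, eulerSlope F h x₀ s

variable {F : E → E} {h β T : ℝ} {x₀ : E}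

theorem eulerSeq_succ (F : E → E) (h : ℝ) (x₀ : E) (k : ℕ) :
    eulerSeq F h x₀ (k + 1) = eulerSeq F h x₀ k + h • F (eulerSeq F h x₀ k) := by
  simp only [eulerSeq, Function.iterate_succ_apply']

/-- Discrete Grönwall: one step multiplies `1 + ‖x‖` by at most `1 + β h ≤ exp (β h)`. The resulting
bound at time `k h` does not otherwise depend on `h`. -/
theorem norm_eulerSeq_le (hF : ∀ x, ‖F x‖ ≤ β * (1 + ‖x‖)) (hh : 0 < h) (x₀ : E) (k : ℕ) :
    1 + ‖eulerSeq F h x₀ k‖ ≤ Real.exp (β * (k * h)) * (1 + ‖x₀‖) := by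
  induction k with
  | zero => simp [eulerSeq]
  | succ k ih =>
    rw [eulerSeq_succ]
    have h1 : ‖eulerSeq F h x₀ k + h • F (eulerSeq F h x₀ k)‖ ≤
        ‖eulerSeq F h x₀ k‖ + h * (β * (1 + ‖eulerSeq F h x₀ k‖)) := by
      refine (norm_add_le _ _).trans ?_
      rw [norm_smul, Real.norm_of_nonneg hh.le]
      gcongr
      exact hF _
    have h2 : 1 + β * h ≤ Real.exp (β * h) := by linarith [Real.add_one_le_exp (β * h)]
    have h3 : Real.exp (β * ((k + 1 : ℕ) * h)) = Real.exp (β * h) * Real.exp (β * (k * h)) := by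
      rw [← Real.exp_add]; push_cast; ring_nf
    rw [h3, mul_assoc]
    calc 1 + ‖eulerSeq F h x₀ k + h • F (eulerSeq F h x₀ k)‖
        ≤ (1 + β * h) * (1 + ‖eulerSeq F h x₀ k‖) := by linarith
      _ ≤ Real.exp (β * h) * (1 + ‖eulerSeq F h x₀ k‖) := by gcongr
      _ ≤ _ := by gcongr

theorem floor_div_mul_le (hh : 0 < h) {s : ℝ} (hs : 0 ≤ s) : (⌊s / h⌋₊ : ℝ) * h ≤ s := by
  have := Nat.floor_le (div_nonneg hs hh.le)
  rwa [le_div_iff₀ hh] at this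

theorem lt_floor_div_add_one_mul (hh : 0 < h) (s : ℝ) : s < (⌊s / h⌋₊ + 1 : ℝ) * h := by
  have := Nat.lt_floor_add_one (s / h)
  rwa [div_lt_iff₀ hh] at this

theorem norm_eulerSlope_le (hβ : 0 ≤ β) (hF : ∀ x, ‖F x‖ ≤ β * (1 + ‖x‖)) (hh : 0 < h) (x₀ : E)
    (hT : 0 ≤ T) {s : ℝ} (hs : s ≤ T) :
    ‖eulerSlope F h x₀ s‖ ≤ β * (Real.exp (β * T) * (1 + ‖x₀‖)) := by
  refine (hF _).trans ?_
  gcongr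
  refine (norm_eulerSeq_le hF hh x₀ _).trans ?_
  gcongr
  rcases le_total 0 s with h0 | h0
  · exact (floor_div_mul_le hh h0).trans hs
  -- At nonpositive times the natural floor is `0` and the slope is `F x₀`, so no lower bound on `s`
  -- is needed.
  · rw [Nat.floor_of_nonpos (div_nonpos_of_nonpos_of_nonneg h0 hh.le)]
    simpa using hT

theorem stronglyMeasurable_eulerSlope (F : E → E) (h : ℝ) (x₀ : E) :
    StronglyMeasurable (eulerSlope F h x₀) :=
  (StronglyMeasurable.of_discrete (f := fun k : ℕ => F (eulerSeq F h x₀ k))).comp_measurable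
    (Nat.measurable_floor.comp (measurable_id.div_const h))

theorem intervalIntegrable_eulerSlope (hβ : 0 ≤ β) (hF : ∀ x, ‖F x‖ ≤ β * (1 + ‖x‖)) (hh : 0 < h)
    (x₀ : E) (a d : ℝ) : IntervalIntegrable (eulerSlope F h x₀) volume a d := by
  rw [intervalIntegrable_iff]
  refine Measure.integrableOn_of_bounded (M := β * (Real.exp (β * |max a d|) * (1 + ‖x₀‖)))
    (by simp) (stronglyMeasurable_eulerSlope F h x₀).aestronglyMeasurable ?_
  refine (ae_restrict_iff' measurableSet_uIoc).2 (Eventually.of_forall fun s hs => ?_)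
  exact norm_eulerSlope_le hβ hF hh x₀ (abs_nonneg _) (hs.2.trans (le_abs_self _))

theorem eulerPath_sub (hβ : 0 ≤ β) (hF : ∀ x, ‖F x‖ ≤ β * (1 + ‖x‖)) (hh : 0 < h)
    (x₀ : E) (a d : ℝ) :
    eulerPath F h x₀ d - eulerPath F h x₀ a = ∫ s in a..d, eulerSlope F h x₀ s := by
  rw [eulerPath, eulerPath, add_sub_add_left_eq_sub]
  exact intervalIntegral.integral_interval_sub_left
    (intervalIntegrable_eulerSlope hβ hF hh x₀ _ _) (intervalIntegrable_eulerSlope hβ hF hh x₀ _ _)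

theorem norm_eulerPath_sub_le (hβ : 0 ≤ β) (hF : ∀ x, ‖F x‖ ≤ β * (1 + ‖x‖)) (hh : 0 < h)
    (x₀ : E) (hT : 0 ≤ T) {a d : ℝ} (ha : a ≤ T) (hd : d ≤ T) :
    ‖eulerPath F h x₀ d - eulerPath F h x₀ a‖ ≤
      β * (Real.exp (β * T) * (1 + ‖x₀‖)) * |d - a| := by
  rw [eulerPath_sub hβ hF hh]
  refine intervalIntegral.norm_integral_le_of_norm_le_const fun s hs => ?_
  exact norm_eulerSlope_le hβ hF hh x₀ hT (hs.2.trans (max_le ha hd))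

theorem eulerPath_natCast_mul [CompleteSpace E] (hβ : 0 ≤ β) (hF : ∀ x, ‖F x‖ ≤ β * (1 + ‖x‖))
    (hh : 0 < h) (x₀ : E) (k : ℕ) : eulerPath F h x₀ (k * h) = eulerSeq F h x₀ k := by
  induction k with
  | zero => simp [eulerPath, eulerSeq]
  | succ k ih =>
    have h1 := eulerPath_sub hβ hF hh x₀ (k * h) ((k + 1 : ℕ) * h)
    have h2 : ∫ s in (k * h)..((k + 1 : ℕ) * h), eulerSlope F h x₀ s =
        ∫ _ in (k * h)..((k + 1 : ℕ) * h), F (eulerSeq F h x₀ k) := by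
      refine intervalIntegral.integral_congr_Ioo_of_le (by push_cast; linarith) fun s hs => ?_
      have : ⌊s / h⌋₊ = k := by
        rw [Nat.floor_eq_iff (div_nonneg ((by positivity : (0 : ℝ) ≤ k * h).trans hs.1.le) hh.le),
          le_div_iff₀ hh, div_lt_iff₀ hh]
        exact ⟨hs.1.le, by simpa using hs.2⟩
      simp [eulerSlope, this]
    rw [h2, intervalIntegral.integral_const, sub_eq_iff_eq_add, ih] at h1
    rw [h1, eulerSeq_succ, add_comm]
    congr 2
    push_cast; ring

/-- The velocity at time `t` is `F` at the last node, not at the polygon itself; this bounds the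
mismatch, the only error of the scheme. -/
theorem norm_eulerPath_sub_eulerSeq_le [CompleteSpace E] (hβ : 0 ≤ β)
    (hF : ∀ x, ‖F x‖ ≤ β * (1 + ‖x‖)) (hh : 0 < h) (x₀ : E) {t : ℝ} (ht : 0 ≤ t) (htT : t ≤ T) :
    ‖eulerPath F h x₀ t - eulerSeq F h x₀ ⌊t / h⌋₊‖ ≤
      β * (Real.exp (β * T) * (1 + ‖x₀‖)) * h := by
  rw [← eulerPath_natCast_mul hβ hF hh]
  have h1 := floor_div_mul_le hh ht
  have h2 := lt_floor_div_add_one_mul hh t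
  refine (norm_eulerPath_sub_le hβ hF hh x₀ (ht.trans htT) (h1.trans htT) htT).trans ?_
  gcongr
  rw [abs_of_nonneg (by linarith)]
  linarith

/-- Only a right derivative: the slope may jump at nodes, but the floor is locally constant to the
right. -/
theorem hasDerivWithinAt_eulerPath [CompleteSpace E] (hβ : 0 ≤ β)
    (hF : ∀ x, ‖F x‖ ≤ β * (1 + ‖x‖)) (hh : 0 < h) (x₀ : E) {t : ℝ} (ht : 0 ≤ t) :
    HasDerivWithinAt (eulerPath F h x₀) (eulerSlope F h x₀ t) (Ici t) t := by
  refine HasDerivWithinAt.const_add x₀ ?_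
  refine intervalIntegral.integral_hasDerivWithinAt_right
    (intervalIntegrable_eulerSlope hβ hF hh x₀ _ _)
    (stronglyMeasurable_eulerSlope F h x₀).stronglyMeasurableAtFilter ?_
  refine ContinuousWithinAt.congr_of_eventuallyEq
    (f := fun _ => eulerSlope F h x₀ t) continuousWithinAt_const ?_ rfl
  have h1 := floor_div_mul_le hh ht
  have h2 := lt_floor_div_add_one_mul hh t
  filter_upwards [mem_nhdsWithin_of_mem_nhds (Iio_mem_nhds h2), self_mem_nhdsWithin] with s hs hs'
  have hs' : t < s := hs'
  have : ⌊s / h⌋₊ = ⌊t / h⌋₊ := by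
    rw [Nat.floor_eq_iff (div_nonneg (ht.trans hs'.le) hh.le), le_div_iff₀ hh, div_lt_iff₀ hh]
    exact ⟨h1.trans hs'.le, hs⟩
  simp [eulerSlope, this]

end Dissipative

/-! ### Existence of global solutions as limits of Euler polygons -/

section Existence

variable {E : Type*} [NormedAddCommGroup E] [NormedSpace ℝ E]
  {b : E →L[ℝ] E →L[ℝ] ℝ} {F : E → E} {T : ℝ} {x₀ : E}

theorem hasDerivWithinAt_form_self (hs : ∀ x y, b x y = b y x) {f : ℝ → E} {f' : E} {s : Set ℝ}
    {t : ℝ} (hf : HasDerivWithinAt f f' s t) :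
    HasDerivWithinAt (fun t => b (f t) (f t)) (2 * b f' (f t)) s t := by
  have := (b.hasFDerivAt.comp_hasDerivWithinAt t hf).clm_apply hf
  have e : 2 * b f' (f t) = b f' (f t) + (b ∘ f) t f' := by
    rw [Function.comp_apply, hs (f t) f', two_mul]
  rw [e]
  exact this

/-- Two Euler polygons from the same point stay close to each other. -/
theorem IsDissipative.form_eulerPath_sub_le [CompleteSpace E] (H : IsDissipative b F) (x₀ : E)
    (hT : 0 ≤ T) : ∃ K ≥ 0, ∀ h > 0, ∀ k > 0, ∀ t ∈ Icc 0 T,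
      ‖eulerPath F h x₀ t - eulerPath F k x₀ t‖ ^ 2 ≤ K * (h + k) := by
  obtain ⟨β, hβ, hF⟩ := H.growth
  obtain ⟨c, hc, hcb⟩ := H.coercive
  set K := β * (Real.exp (β * T) * (1 + ‖x₀‖)) with hK
  have hK0 : 0 ≤ K := by positivity
  -- The form of the difference grows at rate at most `2 ‖b‖ (2K) K (h + k)`: velocities differ by
  -- at most `2K` and nodes lag by `K (h + k)` in total. Integrate up to `T` and divide by the
  -- coercivity constant.
  refine ⟨2 * (‖b‖ * (2 * K) * K) * T / c, by positivity, fun h hh k hk t ht => ?_⟩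
  set d : ℝ → E := fun t => eulerPath F h x₀ t - eulerPath F k x₀ t with hd
  set C := 2 * (‖b‖ * (2 * K) * (K * (h + k))) with hC
  have hder : ∀ s, 0 ≤ s → HasDerivWithinAt d (eulerSlope F h x₀ s - eulerSlope F k x₀ s)
      (Ici s) s := fun s hs =>
    (hasDerivWithinAt_eulerPath hβ hF hh x₀ hs).sub (hasDerivWithinAt_eulerPath hβ hF hk x₀ hs)
  have hcont : ∀ {h : ℝ}, 0 < h → ContinuousOn (eulerPath F h x₀) (Icc 0 T) := fun {h} hh => by
    refine LipschitzOnWith.continuousOn (K := ⟨K, hK0⟩) (LipschitzOnWith.of_dist_le_mul ?_)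
    intro u hu v hv
    rw [dist_eq_norm, Real.dist_eq]
    exact norm_eulerPath_sub_le hβ hF hh x₀ hT hv.2 hu.2
  have hdc : ContinuousOn d (Icc 0 T) := (hcont hh).sub (hcont hk)
  have hφ : ∀ t ∈ Icc 0 T, b (d t) (d t) ≤ C * t := by
    refine image_le_of_deriv_right_le_deriv_boundary (f' := fun t =>
      2 * b (eulerSlope F h x₀ t - eulerSlope F k x₀ t) (d t)) (B' := fun _ => C) ?_ ?_ ?_ ?_ ?_ ?_
    · exact (b.continuous.comp_continuousOn hdc).clm_apply hdc
    · exact fun s hs => hasDerivWithinAt_form_self H.symm (hder s hs.1)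
    · simp [hd, eulerPath]
    · fun_prop
    · intro s _
      simpa using ((hasDerivAt_id s).const_mul C).hasDerivWithinAt
    · intro s hs
      set p := eulerSeq F h x₀ ⌊s / h⌋₊ with hp
      set q := eulerSeq F k x₀ ⌊s / k⌋₊ with hq
      have e1 : eulerSlope F h x₀ s - eulerSlope F k x₀ s = F p - F q := rfl
      -- Dissipativity controls the pairing with the difference of the nodes, leaving only the lag
      -- of order `h + k`.
      have e2 : d s = (p - q) + ((eulerPath F h x₀ s - p) - (eulerPath F k x₀ s - q)) := by
        simp only [hd]; abel
      have n1 : ‖F p - F q‖ ≤ 2 * K := by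
        have a1 : ‖F p‖ ≤ K := norm_eulerSlope_le hβ hF hh x₀ hT hs.2.le
        have a2 : ‖F q‖ ≤ K := norm_eulerSlope_le hβ hF hk x₀ hT hs.2.le
        linarith [norm_sub_le (F p) (F q)]
      have n2 : ‖(eulerPath F h x₀ s - p) - (eulerPath F k x₀ s - q)‖ ≤ K * (h + k) := by
        have a1 := norm_eulerPath_sub_eulerSeq_le hβ hF hh x₀ hs.1 hs.2.le
        have a2 := norm_eulerPath_sub_eulerSeq_le hβ hF hk x₀ hs.1 hs.2.le
        refine (norm_sub_le _ _).trans ?_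
        rw [mul_add]
        exact add_le_add a1 a2
      have n3 := H.dissip p q
      have n4 : b (F p - F q) ((eulerPath F h x₀ s - p) - (eulerPath F k x₀ s - q)) ≤
          ‖b‖ * (2 * K) * (K * (h + k)) := by
        refine (le_abs_self _).trans ((b.le_opNorm₂ _ _).trans ?_)
        gcongr
      rw [e1, e2, map_add]
      linarith
  have h1 := (hcb (d t)).trans (hφ t ht)
  have h2 : C * t ≤ C * T := by
    have : 0 ≤ C := by positivity
    exact mul_le_mul_of_nonneg_left ht.2 this
  rw [div_mul_eq_mul_div, le_div_iff₀ hc, mul_comm]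
  refine (h1.trans h2).trans_eq ?_
  rw [hC]; ring

/-- The Cauchy estimate gives uniform convergence on each `[0, T]` without extracting subsequences,
to a pointwise limit that does not depend on `T`. -/
theorem IsDissipative.exists_limit_eulerPath [CompleteSpace E] (H : IsDissipative b F) (x₀ : E) :
    ∃ X : ℝ → E, ∀ T ≥ 0, ∃ r : ℕ → ℝ, Tendsto r atTop (𝓝 0) ∧ ∀ n : ℕ, ∀ t ∈ Icc 0 T,
      dist (eulerPath F (1 / ((n : ℝ) + 1)) x₀ t) (X t) ≤ r n := by
  have key : ∀ T ≥ 0, ∃ r : ℕ → ℝ, Tendsto r atTop (𝓝 0) ∧ ∀ t ∈ Icc 0 T, ∀ n m N : ℕ, N ≤ n →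
      N ≤ m → dist (eulerPath F (1 / ((n : ℝ) + 1)) x₀ t) (eulerPath F (1 / ((m : ℝ) + 1)) x₀ t) ≤
        r N := by
    intro T hT
    obtain ⟨K, hK, hKd⟩ := H.form_eulerPath_sub_le x₀ hT
    refine ⟨fun n => Real.sqrt (K * (1 / ((n : ℝ) + 1) + 1 / ((n : ℝ) + 1))), ?_, ?_⟩
    · have h0 := tendsto_one_div_add_atTop_nhds_zero_nat (𝕜 := ℝ)
      simpa using ((h0.add h0).const_mul K).sqrt
    · intro t ht n m N hn hm
      rw [dist_eq_norm]
      refine Real.le_sqrt_of_sq_le ((hKd _ (by positivity) _ (by positivity) t ht).trans ?_)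
      gcongr
  have lim : ∀ t, 0 ≤ t → ∃ x, Tendsto (fun n : ℕ => eulerPath F (1 / ((n : ℝ) + 1)) x₀ t) atTop
      (𝓝 x) := fun t ht => by
    obtain ⟨r, hr, h⟩ := key t ht
    exact cauchySeq_tendsto_of_complete
      (cauchySeq_of_le_tendsto_0 r (fun n m N hn hm => h t ⟨ht, le_rfl⟩ n m N hn hm) hr)
  choose! X hX using lim
  refine ⟨X, fun T hT => ?_⟩
  obtain ⟨r, hr, h⟩ := key T hT
  refine ⟨r, hr, fun n t ht => ?_⟩
  refine le_of_tendsto (tendsto_const_nhds.dist (hX t ht.1)) ?_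
  filter_upwards [eventually_ge_atTop n] with m hm
  exact h t ht n m n le_rfl hm

/-- Difference quotients of a polygon are averages of values of `F` at nodes. Near `t` these nodes
lie in the `δ`-ball around `X t`, so the averages, then the quotients of `X`, then its derivative
lie in the closed convex hull. -/
theorem IsDissipative.exists_solution [FiniteDimensional ℝ E] (H : IsDissipative b F) (x₀ : E) :
    ∃ x : ℝ → E, IsKrasowskiiSolutionOn F (Ici 0) x ∧ x 0 = x₀ := by
  have : CompleteSpace E := FiniteDimensional.complete ℝ E
  obtain ⟨β, hβ, hF⟩ := H.growth
  obtain ⟨X, hX⟩ := H.exists_limit_eulerPath x₀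
  have hpos : ∀ n : ℕ, 0 < 1 / ((n : ℝ) + 1) := fun n => by positivity
  have hlim : ∀ t, 0 ≤ t → Tendsto (fun n : ℕ => eulerPath F (1 / ((n : ℝ) + 1)) x₀ t) atTop
      (𝓝 (X t)) := fun t ht => by
    obtain ⟨r, hr, h⟩ := hX t ht
    exact tendsto_iff_dist_tendsto_zero.2
      (squeeze_zero (fun _ => dist_nonneg) (fun n => h n t ⟨ht, le_rfl⟩) hr)
  have hLip : ∀ T, 0 ≤ T → ∃ K, LipschitzOnWith K X (Icc 0 T) := fun T hT => by
    refine ⟨⟨β * (Real.exp (β * T) * (1 + ‖x₀‖)), by positivity⟩,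
      LipschitzOnWith.of_dist_le_mul fun u hu v hv => ?_⟩
    refine le_of_tendsto ((hlim u hu.1).dist (hlim v hv.1)) (Eventually.of_forall fun n => ?_)
    rw [dist_eq_norm, Real.dist_eq]
    exact norm_eulerPath_sub_le hβ hF (hpos n) x₀ hT hv.2 hu.2
  refine ⟨X, ⟨?_, ?_⟩, ?_⟩
  · intro u hu v hv
    have hu : 0 ≤ u := hu
    have hv : 0 ≤ v := hv
    obtain ⟨K, hK⟩ := hLip (max u v) (le_max_of_le_left hu)
    refine (hK.mono ?_).absolutelyContinuousOnInterval
    exact Icc_subset_Icc (le_min hu hv) le_rfl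
  · have hd : ∀ᵐ t : ℝ, ∀ n : ℕ, t ∈ Icc (0 : ℝ) n → DifferentiableWithinAt ℝ X (Icc (0 : ℝ) n) t :=
      ae_all_iff.2 fun n => by
        obtain ⟨K, hK⟩ := hLip n n.cast_nonneg
        exact hK.ae_differentiableWithinAt_of_mem_real
    -- Solutions need a two-sided derivative, which the bounds on `[0, n]` cannot give at `0`.
    have h0 : ∀ᵐ t : ℝ, t ≠ 0 := by simp [ae_iff]
    refine (ae_restrict_iff' measurableSet_Ici).2 ?_
    filter_upwards [hd, h0] with t ht ht0 htm
    have htpos : 0 < t := lt_of_le_of_ne htm (Ne.symm ht0)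
    obtain ⟨n, hn⟩ := exists_nat_gt t
    have hdiff : HasDerivAt X (deriv X t) t :=
      ((ht n ⟨htpos.le, hn.le⟩).differentiableAt (Icc_mem_nhds htpos hn)).hasDerivAt
    refine ⟨_, ?_, hdiff⟩
    simp only [krasowskii, mem_iInter]
    intro δ hδ
    have hslope : Tendsto (slope X t) (𝓝[>] t) (𝓝 (deriv X t)) :=
      (hasDerivAt_iff_tendsto_slope.1 hdiff).mono_left (nhdsWithin_mono _ fun s hs => ne_of_gt hs)
    refine isClosed_closedConvexHull.mem_of_tendsto hslope ?_
    obtain ⟨ρ, hρ, hball⟩ := Metric.continuousAt_iff.1 hdiff.continuousAt (δ / 2) (by positivity)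
    filter_upwards [Ioo_mem_nhdsGT (show t < t + ρ by linarith)] with s hs
    obtain ⟨r, hr, hrX⟩ := hX s (htpos.le.trans hs.1.le)
    have hsl : Tendsto (fun n : ℕ => slope (eulerPath F (1 / ((n : ℝ) + 1)) x₀) t s) atTop
        (𝓝 (slope X t s)) := by
      simp only [slope_def_module]
      exact ((hlim s (htpos.le.trans hs.1.le)).sub (hlim t htpos.le)).const_smul _
    refine isClosed_closedConvexHull.mem_of_tendsto hsl ?_
    -- Node to polygon plus polygon to limit costs less than `δ / 2`; the other half is the
    -- continuity of `X` at `t`.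
    have hsmall : Tendsto (fun n : ℕ => β * (Real.exp (β * s) * (1 + ‖x₀‖)) * (1 / ((n : ℝ) + 1))
        + r n) atTop (𝓝 0) := by
      simpa using (tendsto_one_div_add_atTop_nhds_zero_nat.const_mul
        (β * (Real.exp (β * s) * (1 + ‖x₀‖)))).add hr
    filter_upwards [hsmall.eventually (gt_mem_nhds (show 0 < δ / 2 by positivity))] with n hn
    rw [slope_def_module, eulerPath_sub hβ hF (hpos n), ← interval_average_eq]
    rw [uIoc_of_le hs.1.le]
    refine convex_closedConvexHull.set_average_mem isClosed_closedConvexHull ?_ (by simp) ?_ ?_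
    · simpa using hs.1
    · refine (ae_restrict_iff' measurableSet_Ioc).2 (Eventually.of_forall fun τ hτ => ?_)
      refine subset_closedConvexHull (mem_image_of_mem F ?_)
      have hτ0 : 0 ≤ τ := htpos.le.trans hτ.1.le
      have a1 := norm_eulerPath_sub_eulerSeq_le hβ hF (hpos n) x₀ hτ0 hτ.2
      rw [← dist_eq_norm, dist_comm] at a1
      have a2 := hrX n τ ⟨hτ0, hτ.2⟩
      have a3 : dist (X τ) (X t) < δ / 2 := hball (by
        rw [Real.dist_eq, abs_of_pos (by linarith [hτ.1])]; linarith [hτ.2, hs.2])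
      rw [Metric.mem_ball]
      refine (dist_triangle4 _ (eulerPath F (1 / ((n : ℝ) + 1)) x₀ τ) (X τ) _).trans_lt ?_
      linarith
    · exact (intervalIntegrable_iff_integrableOn_Ioc_of_le hs.1.le).1
        (intervalIntegrable_eulerSlope hβ hF (hpos n) x₀ t s)
  · refine tendsto_nhds_unique (hlim 0 le_rfl) ?_
    simp [eulerPath]

end Existence

/-! ### Absolutely continuous functions -/

section AbsolutelyContinuous

theorem _root_.AbsolutelyContinuousOnInterval.comp_lipschitzOnWith {X Y : Type*}
    [PseudoMetricSpace X] [PseudoMetricSpace Y] {f : ℝ → X} {a d : ℝ}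
    (hf : AbsolutelyContinuousOnInterval f a d) {g : X → Y} {K : NNReal} {s : Set X}
    (hg : LipschitzOnWith K g s) (hs : MapsTo f (uIcc a d) s) :
    AbsolutelyContinuousOnInterval (fun t => g (f t)) a d := by
  rw [absolutelyContinuousOnInterval_iff] at hf ⊢
  intro ε hε
  obtain ⟨δ, hδ, h⟩ := hf (ε / (K + 1)) (by positivity)
  refine ⟨δ, hδ, fun I hI hIδ => ?_⟩
  have h1 := h I hI hIδ
  rw [lt_div_iff₀ (by positivity)] at h1
  refine lt_of_le_of_lt ?_ h1
  rw [Finset.sum_mul]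
  refine Finset.sum_le_sum fun i hi => ?_
  have h2 := hg.dist_le_mul _ (hs (hI.1 i hi).1) _ (hs (hI.1 i hi).2)
  nlinarith [dist_nonneg (x := f (I.2 i).1) (y := f (I.2 i).2)]

theorem _root_.AbsolutelyContinuousOnInterval.comp_const_add {X : Type*}
    [PseudoMetricSpace X] {f : ℝ → X} {a d : ℝ} (s : ℝ)
    (hf : AbsolutelyContinuousOnInterval f (s + a) (s + d)) :
    AbsolutelyContinuousOnInterval (fun t => f (s + t)) a d := by
  rw [absolutelyContinuousOnInterval_iff] at hf ⊢
  intro ε hε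
  obtain ⟨δ, hδ, h⟩ := hf ε hε
  refine ⟨δ, hδ, fun I hI hIδ => ?_⟩
  refine h (I.1, fun i => (s + (I.2 i).1, s + (I.2 i).2)) ⟨fun i hi => ?_, fun i hi j hj hij => ?_⟩
    (by simpa using hIδ)
  · rw [← image_const_add_uIcc]
    exact ⟨mem_image_of_mem _ (hI.1 i hi).1, mem_image_of_mem _ (hI.1 i hi).2⟩
  · have h1 := hI.2 hi hj hij
    simp only [Function.onFun, uIoc, min_add_add_left, max_add_add_left, ← image_const_add_Ioc]
      at h1 ⊢
    exact (disjoint_image_iff (add_right_injective s)).2 h1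

theorem _root_.AbsolutelyContinuousOnInterval.le_of_ae_hasDerivAt_nonpos {f : ℝ → ℝ} {a d : ℝ}
    (hf : AbsolutelyContinuousOnInterval f a d) (had : a ≤ d)
    (h : ∀ᵐ t ∂volume.restrict (Icc a d), ∃ v ≤ 0, HasDerivAt f v t) : f d ≤ f a := by
  have h1 := hf.integral_deriv_eq_sub
  have h2 : ∫ t in a..d, deriv f t ≤ ∫ _ in a..d, (0 : ℝ) := by
    refine intervalIntegral.integral_mono_ae_restrict had hf.intervalIntegrable_deriv (by simp) ?_
    filter_upwards [h] with t ⟨v, hv, ht⟩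
    rwa [ht.deriv]
  rw [h1] at h2
  simp at h2
  exact h2

end AbsolutelyContinuous

/-! ### Contraction and invariance for Krasowskii solutions -/

section Krasowskii

variable {E : Type*} [NormedAddCommGroup E] [NormedSpace ℝ E]
  {b : E →L[ℝ] E →L[ℝ] ℝ} {F : E → E}

theorem mem_krasowskii (F : E → E) (x : E) : F x ∈ krasowskii F x := by
  simp only [krasowskii, mem_iInter]
  exact fun δ hδ => subset_closedConvexHull (mem_image_of_mem F (Metric.mem_ball_self hδ))

/-- A linear inequality satisfied by `F` near `x` up to `ε`, for all `ε > 0`, holds on the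
Krasowskii regularization. -/
theorem le_of_mem_krasowskii {x v : E} (hv : v ∈ krasowskii F x) (l : E →L[ℝ] ℝ) {c : ℝ}
    (h : ∀ ε > 0, ∀ᶠ y in 𝓝 x, l (F y) ≤ c + ε) : l v ≤ c := by
  refine le_of_forall_pos_le_add fun ε hε => ?_
  obtain ⟨δ, hδ, hb⟩ := Metric.eventually_nhds_iff_ball.1 (h ε hε)
  simp only [krasowskii, mem_iInter] at hv
  have hsub : closedConvexHull ℝ (F '' Metric.ball x δ) ⊆ {w | l w ≤ c + ε} := by
    refine closedConvexHull_min ?_ ?_ ?_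
    · rintro _ ⟨y, hy, rfl⟩
      exact hb y hy
    · exact convex_halfSpace_le l.toLinearMap.isLinear _
    · exact isClosed_le l.continuous continuous_const
  exact hsub (hv δ hδ)

/-- `F` may jump at `x`, but linear growth keeps it bounded nearby, so moving the second argument
from `y` to `x` costs nothing in the limit. -/
theorem tendsto_form_sub {β : ℝ} (b : E →L[ℝ] E →L[ℝ] ℝ)
    (hF : ∀ x, ‖F x‖ ≤ β * (1 + ‖x‖)) (x w : E) :
    Tendsto (fun y => b (F y - w) (x - y)) (𝓝 x) (𝓝 0) := by
  have h1 : Tendsto (fun y : E => ‖b‖ * (β * (1 + ‖y‖) + ‖w‖) * ‖x - y‖) (𝓝 x) (𝓝 0) := by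
    have : Continuous (fun y : E => ‖b‖ * (β * (1 + ‖y‖) + ‖w‖) * ‖x - y‖) := by fun_prop
    simpa using this.tendsto x
  refine squeeze_zero_norm (fun y => (b.le_opNorm₂ _ _).trans ?_) h1
  gcongr
  exact (norm_sub_le _ _).trans (add_le_add_left (hF y) _)

/-- A bound on `b (F y - w) (y - x')` near `x` passes to the Krasowskii regularization. -/
theorem IsDissipative.form_le_of_mem_krasowskii (H : IsDissipative b F) {x x' v w : E}
    (hv : v ∈ krasowskii F x) {c : ℝ} (h : ∀ᶠ y in 𝓝 x, b (F y - w) (y - x') ≤ c) :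
    b (v - w) (x - x') ≤ c := by
  obtain ⟨β, -, hF⟩ := H.growth
  have h1 : (b.flip (x - x')) v ≤ c + b w (x - x') := by
    refine le_of_mem_krasowskii hv _ fun ε hε => ?_
    filter_upwards [h, (tendsto_form_sub b hF x w).eventually (gt_mem_nhds hε)] with y hy hy'
    have : b (F y) (x - x') = b (F y - w) (y - x') + b (F y - w) (x - y) + b w (x - x') := by
      rw [← map_add, add_comm (y - x'), sub_add_sub_cancel, ← _root_.add_apply, ← map_add,
        sub_add_cancel]
    simp only [ContinuousLinearMap.flip_apply]
    linarith
  simp only [ContinuousLinearMap.flip_apply] at h1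
  simp only [map_sub, _root_.sub_apply] at h1 ⊢
  linarith

/-- The points are regularized one at a time: first `y` against a fixed value `F x'`, then `x`
against the resulting `w`. -/
theorem IsDissipative.krasowskii_dissip (H : IsDissipative b F) {x y v w : E}
    (hv : v ∈ krasowskii F x) (hw : w ∈ krasowskii F y) : b (v - w) (x - y) ≤ 0 := by
  refine H.form_le_of_mem_krasowskii hv (Eventually.of_forall fun x' => ?_)
  have := H.form_le_of_mem_krasowskii (w := F x') (x' := x') hw (c := 0)
    (Eventually.of_forall fun y' => H.dissip y' x')
  rw [← neg_sub (F x'), ← neg_sub x', map_neg, map_neg, _root_.neg_apply, neg_neg] at this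
  exact this

theorem IsKrasowskiiSolutionOn.mono {I J : Set ℝ} {ξ : ℝ → E} (h : IsKrasowskiiSolutionOn F I ξ)
    (hJ : J ⊆ I) : IsKrasowskiiSolutionOn F J ξ :=
  ⟨fun a ha d hd => h.1 a (hJ ha) d (hJ hd), ae_restrict_of_ae_restrict_of_subset hJ h.2⟩

theorem IsKrasowskiiSolutionOn.comp_const_add {ξ : ℝ → E}
    (h : IsKrasowskiiSolutionOn F (Ici 0) ξ) {s : ℝ} (hs : 0 ≤ s) :
    IsKrasowskiiSolutionOn F (Ici 0) (fun t => ξ (s + t)) := by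
  refine ⟨fun a ha d hd => (h.1 _ (add_nonneg hs ha) _ (add_nonneg hs hd)).comp_const_add s, ?_⟩
  have h1 := (ae_restrict_iff' measurableSet_Ici).1 h.2
  refine (ae_restrict_iff' measurableSet_Ici).2 ?_
  filter_upwards [(measurePreserving_add_left volume s).quasiMeasurePreserving.ae h1] with t ht ht0
  obtain ⟨v, hv, hd⟩ := ht (add_nonneg hs ht0)
  exact ⟨v, hv, hd.comp_const_add s t⟩

theorem IsKrasowskiiSolutionOn.continuousOn {ξ : ℝ → E}
    (h : IsKrasowskiiSolutionOn F (Ici 0) ξ) : ContinuousOn ξ (Ici 0) := by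
  intro t ht
  have ht : 0 ≤ t := ht
  have h1 := (h.1 0 (mem_Ici.2 le_rfl) (t + 1) (mem_Ici.2 (by linarith))).continuousOn t
    (by rw [uIcc_of_le (by linarith)]; exact ⟨ht, by linarith⟩)
  refine h1.mono_of_mem_nhdsWithin ?_
  rw [uIcc_of_le (by linarith), ← Ici_inter_Iic]
  exact inter_mem_nhdsWithin _ (Iic_mem_nhds (by linarith))

theorem absolutelyContinuousOnInterval_form_self (b : E →L[ℝ] E →L[ℝ] ℝ) {f : ℝ → E} {a d : ℝ}
    (hf : AbsolutelyContinuousOnInterval f a d) :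
    AbsolutelyContinuousOnInterval (fun t => b (f t) (f t)) a d := by
  obtain ⟨C, hC⟩ := hf.exists_bound
  have hC0 : 0 ≤ C := (norm_nonneg _).trans (hC a left_mem_uIcc)
  refine hf.comp_lipschitzOnWith (g := fun x => b x x) (K := ⟨‖b‖ * (2 * C), by positivity⟩)
    (s := Metric.closedBall 0 C) (LipschitzOnWith.of_dist_le_mul fun x hx y hy => ?_)
    fun t ht => by simpa using hC t ht
  rw [mem_closedBall_zero_iff] at hx hy
  have e : b x x - b y y = b (x - y) x + b y (x - y) := by simp
  rw [Real.dist_eq, dist_eq_norm, e]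
  have h1 := b.le_opNorm₂ (x - y) x
  have h2 := b.le_opNorm₂ y (x - y)
  have h3 : ‖b‖ * ‖x - y‖ * ‖x‖ ≤ ‖b‖ * ‖x - y‖ * C := by gcongr
  have h4 : ‖b‖ * ‖y‖ * ‖x - y‖ ≤ ‖b‖ * C * ‖x - y‖ := by gcongr
  refine (abs_add_le _ _).trans ((add_le_add (h1.trans h3) (h2.trans h4)).trans_eq ?_)
  change _ = ‖b‖ * (2 * C) * ‖x - y‖
  ring

/-- Krasowskii solutions of a dissipative field do not move away from each other. -/
theorem IsDissipative.form_sub_le (H : IsDissipative b F) {ξ η : ℝ → E} {s t : ℝ} (hst : s ≤ t)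
    (hξ : IsKrasowskiiSolutionOn F (Icc s t) ξ) (hη : IsKrasowskiiSolutionOn F (Icc s t) η) :
    b (ξ t - η t) (ξ t - η t) ≤ b (ξ s - η s) (ξ s - η s) := by
  have hac := (hξ.1 s (left_mem_Icc.2 hst) t (right_mem_Icc.2 hst)).fun_sub
    (hη.1 s (left_mem_Icc.2 hst) t (right_mem_Icc.2 hst))
  refine (absolutelyContinuousOnInterval_form_self b hac).le_of_ae_hasDerivAt_nonpos hst ?_
  filter_upwards [hξ.2, hη.2] with τ ⟨v, hv, hdv⟩ ⟨w, hw, hdw⟩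
  refine ⟨2 * b (v - w) (ξ τ - η τ), ?_, ?_⟩
  · linarith [H.krasowskii_dissip hv hw]
  · rw [← hasDerivWithinAt_univ]
    exact hasDerivWithinAt_form_self H.symm (hdv.sub hdw).hasDerivWithinAt

theorem IsDissipative.eq_of_form_le (H : IsDissipative b F) {x y : E} (h : b (x - y) (x - y) ≤ 0) :
    x = y := by
  obtain ⟨c, hc, hcb⟩ := H.coercive
  have h1 : ‖x - y‖ ^ 2 ≤ 0 := by nlinarith [hcb (x - y)]
  rw [← sub_eq_zero, ← norm_eq_zero]
  exact pow_eq_zero_iff two_ne_zero |>.1 (le_antisymm h1 (sq_nonneg _))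

/-- No gluing is needed: the global solution from `ξ 0` starts at distance zero from `ξ`, and this
distance cannot grow on `I`. -/
theorem IsDissipative.exists_extension [FiniteDimensional ℝ E] (H : IsDissipative b F) {I : Set ℝ}
    (hI : I.OrdConnected) (h0 : IsLeast I 0) {ξ : ℝ → E} (hξ : IsKrasowskiiSolutionOn F I ξ) :
    ∃ η : ℝ → E, IsKrasowskiiSolutionOn F (Ici 0) η ∧ EqOn η ξ I := by
  obtain ⟨η, hη, hη0⟩ := H.exists_solution (ξ 0)
  refine ⟨η, hη, fun t ht => H.eq_of_form_le ?_⟩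
  refine (H.form_sub_le (h0.2 ht) (hη.mono Icc_subset_Ici_self)
    (hξ.mono (hI.out h0.1 ht))).trans_eq ?_
  simp [hη0]

theorem isKrasowskiiSolutionOn_zero (h0 : F 0 = 0) (I : Set ℝ) :
    IsKrasowskiiSolutionOn F I (fun _ => 0) := by
  refine ⟨fun a _ d _ => ?_, Eventually.of_forall fun t => ⟨0, ?_, hasDerivAt_const _ _⟩⟩
  · exact (LipschitzWith.const (0 : E)).lipschitzOnWith.absolutelyContinuousOnInterval
  · simpa [h0] using mem_krasowskii F 0

/-- The invariance principle for dissipative fields: if the quadratic form of `b` decreases at a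
definite rate outside a closed set `S`, then Krasowskii solutions converge to the largest weakly
invariant subset of `S`. -/
theorem IsDissipative.convergesToSet [FiniteDimensional ℝ E] (H : IsDissipative b F)
    (hF0 : F 0 = 0) {S : Set E} (hS : IsClosed S) {c : ℝ} (hc : 0 < c)
    (hFS : ∀ x ∉ S, b (F x) x ≤ -c) {ξ : ℝ → E} (hξ : IsKrasowskiiSolutionOn F (Ici 0) ξ) :
    ConvergesToSet ξ (largestWeaklyInvariantSubset F S) := by
  have : ProperSpace E := FiniteDimensional.proper ℝ E
  obtain ⟨c₀, hc₀, hcb⟩ := H.coercive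
  -- Compare with the zero solution.
  have hanti : ∀ {η : ℝ → E}, IsKrasowskiiSolutionOn F (Ici 0) η → ∀ s t, 0 ≤ s → s ≤ t →
      b (η t) (η t) ≤ b (η s) (η s) := fun {η} hη s t hs hst => by
    have hsub : Icc s t ⊆ Ici 0 := Icc_subset_Ici_iff hst |>.2 hs
    simpa using H.form_sub_le hst (hη.mono hsub) (isKrasowskiiSolutionOn_zero hF0 _)
  have hb0 : ∀ x, 0 ≤ b x x := fun x => (by positivity : 0 ≤ c₀ * ‖x‖ ^ 2).trans (hcb x)
  -- the quadratic form converges along the solution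
  obtain ⟨l, hl⟩ : ∃ l, Tendsto (fun t => b (ξ t) (ξ t)) atTop (𝓝 l) := by
    have hA : Antitone (fun t => b (ξ (max t 0)) (ξ (max t 0))) := fun s t hst =>
      hanti hξ _ _ (le_max_right _ _) (max_le_max_right 0 hst)
    refine ⟨_, (tendsto_atTop_ciInf hA ⟨0, ?_⟩).congr' ?_⟩
    · rintro _ ⟨t, rfl⟩
      exact hb0 _
    · filter_upwards [eventually_ge_atTop 0] with t ht
      rw [max_eq_left ht]
  set Ω : Set E := {x | MapClusterPt x atTop ξ} with hΩ
  have hVΩ : ∀ x ∈ Ω, b x x = l := fun x hx => by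
    have h1 : MapClusterPt (b x x) atTop (fun t => b (ξ t) (ξ t)) := by
      have hcont : Continuous fun y => b y y := by fun_prop
      exact hx.continuousAt_comp hcont.continuousAt
    have h2 := h1.clusterPt.mono (show Filter.map _ _ ≤ 𝓝 l from hl)
    exact eq_of_nhds_neBot h2
  -- If `ξ s` is close to `x`, contraction keeps `ξ (s + t)` as close to `η t`; such `s` are
  -- arbitrarily large. This works for every solution `η` from `x`.
  have hinv : ∀ x ∈ Ω, ∀ η : ℝ → E, IsKrasowskiiSolutionOn F (Ici 0) η → η 0 = x →
      ∀ t ∈ Ici (0 : ℝ), η t ∈ Ω := by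
    intro x hx η hη hη0 t ht
    rw [hΩ, mem_ofPred_eq, mapClusterPt_iff_frequently]
    intro U hU
    obtain ⟨ε, hε, hεU⟩ := Metric.mem_nhds_iff.1 hU
    have hnear : ∀ᶠ y in 𝓝 x, b (y - x) (y - x) < c₀ * ε ^ 2 := by
      have hcont : Continuous fun y => b (y - x) (y - x) := by fun_prop
      have := hcont.tendsto x
      simp only [sub_self, map_zero] at this
      exact this.eventually (gt_mem_nhds (by positivity))
    have hfreq := (mapClusterPt_iff_frequently.1 hx _ hnear).and_eventually (eventually_ge_atTop 0)
    have hshift : Tendsto (fun s : ℝ => s + t) atTop atTop := tendsto_atTop_add_const_right _ _ tendsto_id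
    refine hshift.frequently (hfreq.mono ?_)
    rintro s ⟨hs, hs0⟩
    have h1 := H.form_sub_le (mem_Ici.1 ht) ((hξ.comp_const_add hs0).mono Icc_subset_Ici_self)
      (hη.mono Icc_subset_Ici_self)
    simp only [add_zero, hη0] at h1
    refine hεU ?_
    rw [Metric.mem_ball, dist_eq_norm]
    have h2 := ((hcb _).trans h1).trans_lt hs
    exact lt_of_pow_lt_pow_left₀ 2 hε.le (lt_of_mul_lt_mul_left h2 hc₀.le)
  -- A solution from a point of `Ω` outside `S` stays in `Ω`, where the form is constant, yet for a
  -- short time it is outside the closed set `S`, where the form strictly decreases.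
  have hΩS : Ω ⊆ S := by
    intro x hx
    by_contra hxS
    obtain ⟨η, hη, hη0⟩ := H.exists_solution x
    have hmem := hinv x hx η hη hη0
    have hev : ∀ᶠ t in 𝓝[≥] (0 : ℝ), η t ∉ S :=
      (hη.continuousOn 0 (mem_Ici.2 le_rfl)).eventually
        (by rw [hη0]; exact hS.isOpen_compl.mem_nhds hxS)
    obtain ⟨u, hu, hsub⟩ := mem_nhdsGE_iff_exists_Ico_subset.1 hev
    have hu : 0 < u := hu
    have hae : ∀ᵐ t ∂volume.restrict (Ioo 0 u), ∃ v ∈ krasowskii F (η t), HasDerivAt η v t :=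
      ae_restrict_of_ae_restrict_of_subset (fun t ht => ht.1.le) hη.2
    -- Positive measure turns the almost everywhere derivative into one actual time `t`.
    have : NeZero (volume.restrict (Ioo 0 u)) := ⟨by
      rw [Ne, Measure.restrict_eq_zero]; simpa using hu⟩
    obtain ⟨t, ⟨v, hv, hvd⟩, ht⟩ := (hae.and (ae_restrict_mem measurableSet_Ioo)).exists
    have hbv : b v (η t) ≤ -c := by
      have := H.form_le_of_mem_krasowskii (w := 0) (x' := 0) hv (c := -c) (by
        filter_upwards [hS.isOpen_compl.mem_nhds (hsub ⟨ht.1.le, ht.2⟩)] with y hy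
        simpa using hFS y hy)
      simpa using this
    have hd1 : HasDerivAt (fun t => b (η t) (η t)) (2 * b v (η t)) t := by
      rw [← hasDerivWithinAt_univ]
      exact hasDerivWithinAt_form_self H.symm hvd.hasDerivWithinAt
    have hd2 : HasDerivAt (fun t => b (η t) (η t)) 0 t := by
      refine (hasDerivAt_const t l).congr_of_eventuallyEq ?_
      filter_upwards [Ioi_mem_nhds ht.1] with s hs
      exact hVΩ _ (hmem s (mem_Ici.2 (le_of_lt hs)))
    linarith [hd1.unique hd2]
  have hΩW : Ω ⊆ largestWeaklyInvariantSubset F S := by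
    refine subset_sUnion_of_mem ⟨hΩS, fun x hx => ?_⟩
    obtain ⟨η, hη, hη0⟩ := H.exists_solution x
    exact ⟨η, hη, hη0, hinv x hx η hη hη0⟩
  intro ε hε
  by_contra! hcon
  choose τ hτ hfar using hcon
  -- The trajectory is bounded, so the times at which it is far from the limit set would produce a
  -- cluster point, which belongs to `Ω`.
  obtain ⟨R, hR⟩ : ∃ R, ∀ t ≥ 0, ξ t ∈ Metric.closedBall 0 R := by
    refine ⟨Real.sqrt (b (ξ 0) (ξ 0) / c₀), fun t ht => ?_⟩
    rw [mem_closedBall_zero_iff]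
    refine Real.le_sqrt_of_sq_le ?_
    rw [le_div_iff₀ hc₀, mul_comm]
    exact (hcb _).trans (hanti hξ 0 t le_rfl ht)
  have hτlim : Tendsto (fun n : ℕ => τ n) atTop atTop :=
    tendsto_atTop_mono (fun n => hτ n) tendsto_natCast_atTop_atTop
  obtain ⟨x, -, φ, hφ, hx⟩ := (isCompact_closedBall (0 : E) R).tendsto_subseq
    (x := fun n : ℕ => ξ (τ n)) fun n => hR _ (n.cast_nonneg.trans (hτ n))
  have hxΩ : x ∈ Ω := by
    have := hx.mapClusterPt
    exact MapClusterPt.of_comp (hτlim.comp hφ.tendsto_atTop) this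
  obtain ⟨n, hn⟩ := (hx.eventually (Metric.ball_mem_nhds x hε)).exists
  exact absurd hn (not_lt.2 (hfar _ x (hΩW hxΩ)))

end Krasowskii

/-! ### Monotonicity and sector bounds of the quantizer -/

section Quantizer

variable {Δ r s : ℝ}

theorem quantizer_zero (Δ : ℝ) : quantizer Δ 0 = 0 := by
  have : ⌊(1 / 2 : ℝ)⌋ = 0 := by norm_num
  simp [quantizer, -one_div, this]

theorem quantizer_mono (hΔ : 0 < Δ) : Monotone (quantizer Δ) := fun r s hrs => by
  unfold quantizer
  gcongr

theorem abs_quantizer_sub_le (hΔ : 0 < Δ) (r : ℝ) : |quantizer Δ r - r| ≤ Δ / 2 := by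
  have h1 := Int.floor_le (r / Δ + 1 / 2)
  have h2 := Int.lt_floor_add_one (r / Δ + 1 / 2)
  have h3 : Δ * (r / Δ) = r := by field_simp
  rw [abs_le, quantizer]
  constructor <;> nlinarith

theorem quantizer_sub_mul_sub_nonneg (hΔ : 0 < Δ) (r s : ℝ) :
    0 ≤ (quantizer Δ r - quantizer Δ s) * (r - s) := by
  rcases le_total r s with h | h
  · exact mul_nonneg_of_nonpos_of_nonpos (sub_nonpos.2 (quantizer_mono hΔ h)) (sub_nonpos.2 h)
  · exact mul_nonneg (sub_nonneg.2 (quantizer_mono hΔ h)) (sub_nonneg.2 h)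

theorem quantizer_mul_self_nonneg (hΔ : 0 < Δ) (r : ℝ) : 0 ≤ quantizer Δ r * r := by
  simpa [quantizer_zero] using quantizer_sub_mul_sub_nonneg hΔ r 0

/-- Beyond the threshold the quantized value has modulus at least `Δ` and the sign of `r`.
Strictness matters on the negative side: `-Δ / 2` is rounded up to `0`. -/
theorem le_quantizer_mul_self (hΔ : 0 < Δ) (hr : Δ / 2 < |r|) :
    Δ ^ 2 / 2 ≤ quantizer Δ r * r := by
  rcases lt_abs.1 hr with h | h
  · have h1 : (1 : ℤ) ≤ ⌊r / Δ + 1 / 2⌋ := by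
      rw [Int.le_floor]
      have : 1 / 2 < r / Δ := by rw [lt_div_iff₀ hΔ]; linarith
      push_cast; linarith
    have h2 : (1 : ℝ) ≤ ⌊r / Δ + 1 / 2⌋ := by exact_mod_cast h1
    have h3 : Δ ≤ quantizer Δ r := le_mul_of_one_le_right hΔ.le h2
    nlinarith
  · have h1 : ⌊r / Δ + 1 / 2⌋ < (0 : ℤ) := by
      rw [Int.floor_lt]
      have : r / Δ < -(1 / 2) := by rw [div_lt_iff₀ hΔ]; linarith
      push_cast; linarith
    have h2 : (⌊r / Δ + 1 / 2⌋ : ℝ) ≤ -1 := by exact_mod_cast Int.le_sub_one_of_lt h1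
    have h3 : quantizer Δ r ≤ -Δ := by unfold quantizer; nlinarith
    nlinarith

end Quantizer

/-! ### Matrices and coercive forms -/

section LinearAlgebra

theorem mulVec_dotProduct {ι κ : Type*} [Fintype ι] [Fintype κ] (S : Matrix ι κ ℝ) (x : κ → ℝ)
    (y : ι → ℝ) : (S *ᵥ x) ⬝ᵥ y = x ⬝ᵥ (Sᵀ *ᵥ y) := by
  rw [dotProduct_mulVec, vecMul_transpose]

theorem exists_norm_mulVec_le {ι κ : Type*} [Fintype ι] [Fintype κ] (S : Matrix ι κ ℝ) :
    ∃ C ≥ 0, ∀ x, ‖S *ᵥ x‖ ≤ C * ‖x‖ :=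
  ⟨‖S.mulVecLin.toContinuousLinearMap‖, norm_nonneg _,
    S.mulVecLin.toContinuousLinearMap.le_opNorm⟩

/-- A positive definite continuous bilinear form in finite dimension is coercive. -/
theorem exists_coercive {E : Type*} [NormedAddCommGroup E] [NormedSpace ℝ E]
    [FiniteDimensional ℝ E] (b : E →L[ℝ] E →L[ℝ] ℝ) (hb : ∀ x ≠ 0, 0 < b x x) :
    ∃ c > 0, ∀ x, c * ‖x‖ ^ 2 ≤ b x x := by
  have : ProperSpace E := FiniteDimensional.proper ℝ E
  have hcont : Continuous fun y => b y y := by fun_prop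
  rcases subsingleton_or_nontrivial E with h | h
  · exact ⟨1, one_pos, fun x => by simp [Subsingleton.elim x 0]⟩
  obtain ⟨u, hu, hmin⟩ := (isCompact_sphere (0 : E) 1).exists_isMinOn
    (NormedSpace.sphere_nonempty.2 zero_le_one) hcont.continuousOn
  refine ⟨b u u, hb u (ne_zero_of_mem_unit_sphere ⟨u, hu⟩), fun x => ?_⟩
  rcases eq_or_ne x 0 with rfl | hx
  · simp
  have hx' : 0 < ‖x‖ := norm_pos_iff.2 hx
  have h1 : b u u ≤ b (‖x‖⁻¹ • x) (‖x‖⁻¹ • x) :=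
    hmin (by simp [norm_smul, hx'.ne'] : ‖x‖⁻¹ • x ∈ Metric.sphere (0 : E) 1)
  simp only [map_smul, _root_.smul_apply, smul_eq_mul] at h1
  calc b u u * ‖x‖ ^ 2 ≤ ‖x‖⁻¹ * (‖x‖⁻¹ * b x x) * ‖x‖ ^ 2 := by gcongr
    _ = b x x := by field_simp

end LinearAlgebra

/-! ### Dissipativity and decay for the closed loop -/

section ClosedLoop

variable {N M n p : ℕ} {Δ : ℝ} {D : Matrix (Fin N) (Fin M) ℝ} {A P : Matrix (Fin n) (Fin n) ℝ}
  {B : Matrix (Fin n) (Fin p) ℝ} {C : Matrix (Fin p) (Fin n) ℝ}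

/-- The bilinear form of `I_N ⊗ P` on the state space of the network. -/
noncomputable def networkForm (N : ℕ) (P : Matrix (Fin n) (Fin n) ℝ) :
    (Fin N × Fin n → ℝ) →L[ℝ] (Fin N × Fin n → ℝ) →L[ℝ] ℝ :=
  (Matrix.toLinearMap₂' ℝ ((1 : Matrix (Fin N) (Fin N) ℝ) ⊗ₖ P)).toContinuousBilinearMap

theorem networkForm_apply (P : Matrix (Fin n) (Fin n) ℝ) (x y : Fin N × Fin n → ℝ) :
    networkForm N P x y = x ⬝ᵥ (((1 : Matrix (Fin N) (Fin N) ℝ) ⊗ₖ P) *ᵥ y) := by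
  rw [networkForm, LinearMap.toContinuousBilinearMap_apply, Matrix.toLinearMap₂'_apply']

theorem relativeOutput_sub (D : Matrix (Fin N) (Fin M) ℝ) (C : Matrix (Fin p) (Fin n) ℝ)
    (x y : Fin N × Fin n → ℝ) :
    relativeOutput D C (x - y) = relativeOutput D C x - relativeOutput D C y := by
  simp only [relativeOutput, mulVec_sub]

theorem continuous_relativeOutput (D : Matrix (Fin N) (Fin M) ℝ) (C : Matrix (Fin p) (Fin n) ℝ) :
    Continuous (relativeOutput D C) := by
  unfold relativeOutput
  fun_prop

/-- The passivity inequality of the network with input `-(D ⊗ I_p) w`. -/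
theorem networkForm_le (hP : P.PosDef) (hA : (-(Aᵀ * P + P * A)).PosSemidef) (hB : Bᵀ * P = C)
    (D : Matrix (Fin N) (Fin M) ℝ) (u : Fin N × Fin n → ℝ) (w : Fin M × Fin p → ℝ) :
    networkForm N P (((1 : Matrix (Fin N) (Fin N) ℝ) ⊗ₖ A) *ᵥ u +
      ((1 : Matrix (Fin N) (Fin N) ℝ) ⊗ₖ B) *ᵥ
        (-((D ⊗ₖ (1 : Matrix (Fin p) (Fin p) ℝ)) *ᵥ w))) u ≤ -(w ⬝ᵥ relativeOutput D C u) := by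
  have hPt : Pᵀ = P := by simpa using hP.isHermitian.eq
  have h1 : (((1 : Matrix (Fin N) (Fin N) ℝ) ⊗ₖ A) *ᵥ u) ⬝ᵥ
      (((1 : Matrix (Fin N) (Fin N) ℝ) ⊗ₖ P) *ᵥ u) =
      u ⬝ᵥ (((1 : Matrix (Fin N) (Fin N) ℝ) ⊗ₖ (Aᵀ * P)) *ᵥ u) := by
    rw [mulVec_dotProduct, mulVec_mulVec, ← kroneckerMap_transpose, transpose_one,
      ← mul_kronecker_mul, one_mul]
  -- By symmetry of `P` both halves of the Lyapunov form agree, so each is nonpositive.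
  have h2 : u ⬝ᵥ (((1 : Matrix (Fin N) (Fin N) ℝ) ⊗ₖ (Aᵀ * P)) *ᵥ u) =
      u ⬝ᵥ (((1 : Matrix (Fin N) (Fin N) ℝ) ⊗ₖ (P * A)) *ᵥ u) := by
    rw [dotProduct_comm, mulVec_dotProduct, ← kroneckerMap_transpose, transpose_one,
      transpose_mul, transpose_transpose, hPt]
  have h3 : 0 ≤ -(u ⬝ᵥ (((1 : Matrix (Fin N) (Fin N) ℝ) ⊗ₖ (Aᵀ * P)) *ᵥ u) +
      u ⬝ᵥ (((1 : Matrix (Fin N) (Fin N) ℝ) ⊗ₖ (P * A)) *ᵥ u)) := by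
    have := (PosSemidef.one (n := Fin N) (R := ℝ)).kronecker hA |>.dotProduct_mulVec_nonneg u
    rwa [← neg_one_smul ℝ (Aᵀ * P + P * A), kronecker_smul, kronecker_add, neg_one_smul,
      neg_mulVec, dotProduct_neg, add_mulVec, dotProduct_add, star_trivial] at this
  -- Here `BᵀP = C` enters: the adjoint of the input map for the form is the relative output.
  have h4 : (((1 : Matrix (Fin N) (Fin N) ℝ) ⊗ₖ B) *ᵥ
      ((D ⊗ₖ (1 : Matrix (Fin p) (Fin p) ℝ)) *ᵥ w)) ⬝ᵥ
      (((1 : Matrix (Fin N) (Fin N) ℝ) ⊗ₖ P) *ᵥ u) = w ⬝ᵥ relativeOutput D C u := by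
    rw [mulVec_dotProduct, mulVec_dotProduct, ← kroneckerMap_transpose, ← kroneckerMap_transpose,
      transpose_one, transpose_one, mulVec_mulVec (M := (1 : Matrix (Fin N) (Fin N) ℝ) ⊗ₖ Bᵀ),
      ← mul_kronecker_mul, one_mul, hB, relativeOutput]
  rw [networkForm_apply, add_dotProduct, mulVec_neg, neg_dotProduct, h4, h1]
  linarith

theorem closedLoop_zero (Δ : ℝ) (D : Matrix (Fin N) (Fin M) ℝ) (A : Matrix (Fin n) (Fin n) ℝ)
    (B : Matrix (Fin n) (Fin p) ℝ) (C : Matrix (Fin p) (Fin n) ℝ) :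
    closedLoop Δ D A B C 0 = 0 := by
  have : (fun _ : Fin M × Fin p => (0 : ℝ)) = 0 := rfl
  simp [closedLoop, quantizedFeedback, relativeOutput, quantizer_zero, this]

/-- The quantizer differs from the identity by at most `Δ / 2`, so the growth is that of a linear
map plus a constant. -/
theorem exists_norm_closedLoop_le (hΔ : 0 < Δ) (D : Matrix (Fin N) (Fin M) ℝ)
    (A : Matrix (Fin n) (Fin n) ℝ) (B : Matrix (Fin n) (Fin p) ℝ) (C : Matrix (Fin p) (Fin n) ℝ) :
    ∃ β ≥ 0, ∀ x, ‖closedLoop Δ D A B C x‖ ≤ β * (1 + ‖x‖) := by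
  obtain ⟨c₁, h₁, hc₁⟩ := exists_norm_mulVec_le ((1 : Matrix (Fin N) (Fin N) ℝ) ⊗ₖ A)
  obtain ⟨c₂, h₂, hc₂⟩ := exists_norm_mulVec_le ((1 : Matrix (Fin N) (Fin N) ℝ) ⊗ₖ B)
  obtain ⟨c₃, h₃, hc₃⟩ := exists_norm_mulVec_le (D ⊗ₖ (1 : Matrix (Fin p) (Fin p) ℝ))
  obtain ⟨c₄, h₄, hc₄⟩ := exists_norm_mulVec_le (Dᵀ ⊗ₖ (1 : Matrix (Fin p) (Fin p) ℝ))
  obtain ⟨c₅, h₅, hc₅⟩ := exists_norm_mulVec_le ((1 : Matrix (Fin N) (Fin N) ℝ) ⊗ₖ C)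
  refine ⟨c₁ + c₂ * (c₃ * (c₄ * c₅ + Δ / 2)), by positivity, fun x => ?_⟩
  have hz : ‖relativeOutput D C x‖ ≤ c₄ * (c₅ * ‖x‖) :=
    (hc₄ _).trans (mul_le_mul_of_nonneg_left (hc₅ x) h₄)
  have hq : ‖fun a => quantizer Δ (relativeOutput D C x a)‖ ≤ c₄ * (c₅ * ‖x‖) + Δ / 2 := by
    refine (pi_norm_le_iff_of_nonneg (by positivity)).2 fun a => ?_
    have h1 := norm_le_pi_norm (relativeOutput D C x) a
    have h2 := abs_quantizer_sub_le hΔ (relativeOutput D C x a)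
    have h3 := abs_add_le (relativeOutput D C x a)
      (quantizer Δ (relativeOutput D C x a) - relativeOutput D C x a)
    rw [add_sub_cancel] at h3
    rw [Real.norm_eq_abs] at h1 ⊢
    linarith
  have hu : ‖quantizedFeedback Δ D C x‖ ≤ c₃ * (c₄ * (c₅ * ‖x‖) + Δ / 2) := by
    rw [quantizedFeedback, norm_neg]
    exact (hc₃ _).trans (mul_le_mul_of_nonneg_left hq h₃)
  calc ‖closedLoop Δ D A B C x‖ ≤ c₁ * ‖x‖ + c₂ * (c₃ * (c₄ * (c₅ * ‖x‖) + Δ / 2)) :=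
        (norm_add_le _ _).trans (add_le_add (hc₁ x)
          ((hc₂ _).trans (mul_le_mul_of_nonneg_left hu h₂)))
    _ ≤ c₁ * (1 + ‖x‖) + c₂ * (c₃ * (c₄ * (c₅ * (1 + ‖x‖)) + Δ / 2 * (1 + ‖x‖))) := by
        have hx : ‖x‖ ≤ 1 + ‖x‖ := by linarith
        have hx1 : Δ / 2 ≤ Δ / 2 * (1 + ‖x‖) :=
          le_mul_of_one_le_right (by positivity) (by linarith [norm_nonneg x])
        gcongr
    _ = _ := by ring

theorem closedLoop_isDissipative (hP : P.PosDef) (hA : (-(Aᵀ * P + P * A)).PosSemidef)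
    (hB : Bᵀ * P = C) (hΔ : 0 < Δ) (D : Matrix (Fin N) (Fin M) ℝ) :
    IsDissipative (networkForm N P) (closedLoop Δ D A B C) where
  symm x y := by
    have hPt : Pᵀ = P := by simpa using hP.isHermitian.eq
    rw [networkForm_apply, networkForm_apply, dotProduct_comm, mulVec_dotProduct,
      ← kroneckerMap_transpose, transpose_one, hPt]
  coercive := exists_coercive _ fun x hx => by
    rw [networkForm_apply]
    simpa using ((PosDef.one (n := Fin N) (R := ℝ)).kronecker hP).dotProduct_mulVec_pos hx
  growth := exists_norm_closedLoop_le hΔ D A B C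
  dissip x y := by
    -- The non-quantized part is linear, so the passivity inequality applies to `x - y` with the
    -- difference of the quantized outputs as input.
    have h := networkForm_le hP hA hB D (x - y) ((fun a => quantizer Δ (relativeOutput D C x a)) -
      fun a => quantizer Δ (relativeOutput D C y a))
    have e : closedLoop Δ D A B C x - closedLoop Δ D A B C y =
        ((1 : Matrix (Fin N) (Fin N) ℝ) ⊗ₖ A) *ᵥ (x - y) +
        ((1 : Matrix (Fin N) (Fin N) ℝ) ⊗ₖ B) *ᵥ (-((D ⊗ₖ (1 : Matrix (Fin p) (Fin p) ℝ)) *ᵥ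
          ((fun a => quantizer Δ (relativeOutput D C x a)) -
            fun a => quantizer Δ (relativeOutput D C y a)))) := by
      simp only [closedLoop, quantizedFeedback, mulVec_sub, mulVec_neg]
      abel
    rw [e]
    refine h.trans (neg_nonpos.2 ?_)
    rw [relativeOutput_sub]
    exact Finset.sum_nonneg fun a _ => quantizer_sub_mul_sub_nonneg hΔ _ _

/-- One violating coordinate already dissipates `Δ ^ 2 / 2`; all the others contribute with the
right sign. -/
theorem networkForm_closedLoop_le (hP : P.PosDef) (hA : (-(Aᵀ * P + P * A)).PosSemidef)
    (hB : Bᵀ * P = C) (hΔ : 0 < Δ) (D : Matrix (Fin N) (Fin M) ℝ) {x : Fin N × Fin n → ℝ}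
    (hx : x ∉ practicalSyncSet Δ D C) :
    networkForm N P (closedLoop Δ D A B C x) x ≤ -(Δ ^ 2 / 2) := by
  obtain ⟨k, j, hkj⟩ : ∃ k j, Δ / 2 < |relativeOutput D C x (k, j)| := by
    simpa [practicalSyncSet] using hx
  refine (networkForm_le hP hA hB D x _).trans (neg_le_neg ?_)
  refine (le_quantizer_mul_self hΔ hkj).trans ?_
  exact Finset.single_le_sum (f := fun a => quantizer Δ (relativeOutput D C x a) *
    relativeOutput D C x a) (fun a _ => quantizer_mul_self_nonneg hΔ _) (Finset.mem_univ (k, j))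

theorem isClosed_practicalSyncSet (Δ : ℝ) (D : Matrix (Fin N) (Fin M) ℝ)
    (C : Matrix (Fin p) (Fin n) ℝ) : IsClosed (practicalSyncSet Δ D C) := by
  simp only [practicalSyncSet, ofPred_forall]
  exact isClosed_iInter fun k => isClosed_iInter fun j => isClosed_le
    (continuous_abs.comp ((continuous_apply (k, j)).comp (continuous_relativeOutput D C)))
    continuous_const

end ClosedLoop

end QuantSync

theorem mainTheorem5 {N M n p : ℕ}
    (G : SimpleGraph (Fin N)) (hG : G.Connected) (L : EdgeLabelling G M)
    (A : Matrix (Fin n) (Fin n) ℝ) (B : Matrix (Fin n) (Fin p) ℝ) (C : Matrix (Fin p) (Fin n) ℝ)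
    (hP : PassivityAssumption A B C) (Δ : ℝ) (hΔ : 0 < Δ) :
    (∀ (I : Set ℝ), I.OrdConnected → IsLeast I 0 →
      ∀ ξ : ℝ → (Fin N × Fin n → ℝ),
        IsKrasowskiiSolutionOn (closedLoop Δ L.incidence A B C) I ξ →
        ∃ η : ℝ → (Fin N × Fin n → ℝ),
          IsKrasowskiiSolutionOn (closedLoop Δ L.incidence A B C) (Ici 0) η ∧ EqOn η ξ I) ∧
    (∀ ξ : ℝ → (Fin N × Fin n → ℝ),
        IsKrasowskiiSolutionOn (closedLoop Δ L.incidence A B C) (Ici 0) ξ →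
        ConvergesToSet ξ
          (largestWeaklyInvariantSubset (closedLoop Δ L.incidence A B C)
            (practicalSyncSet Δ L.incidence C))) := by
  obtain ⟨P, hPd, hA, hB⟩ := hP
  have H := closedLoop_isDissipative hPd hA hB hΔ L.incidence
  exact ⟨fun I hI h0 ξ hξ => H.exists_extension hI h0 hξ, fun ξ hξ =>
    H.convergesToSet (closedLoop_zero Δ L.incidence A B C)
      (isClosed_practicalSyncSet Δ L.incidence C) (by positivity)
      (fun x hx => networkForm_closedLoop_le hPd hA hB hΔ L.incidence hx) hξ⟩
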